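/- Consider $N$ spins labelled by $\Lambda=\{1,\dots,N\}$, each with Hilbert space $\mathbb{C}^d$, and write $\|\cdot\|$ for the operator norm on $(\mathbb{C}^d)^{\otimes N}$. For an integer $q\ge 1$, an operator $\Gamma$ on $(\mathbb{C}^d)^{\otimes N}$ is called $q$-local if $\Gamma=\sum_{X\subseteq\Lambda,\ |X|\le q}\gamma_X$ for some operators $\gamma_X$, each supported in $X$ (that is, acting as the identity on the spins outside $X$). Let $k\ge 1$ be an integer and $g\ge 0$ a real number. A self-adjoint operator $H$ on $(\mathbb{C}^d)^{\otimes N}$ is called a $k$-local $g$-extensive Hamiltonian if $H=\sum_{X\subseteq\Lambda,\ |X|\le k}h_X$ for some operators $h_X$, each supported in $X$, such that $\sum_{X\ni i}\|h_X\|\le g$ for every $i\in\Lambda$. **Theorem.** Let $H$ be a $k$-local $g$-extensive Hamiltonian, let $q\ge 1$ be an integer, and let $\Gamma$ be any $q$-local operator (neither self-adjointness nor extensiveness of $\Gamma$ is assumed). Then $$\|[H,\Gamma]\|\le 6\,g\,k\,q\,\|\Gamma\|,$$ that is, $\|[H,\Gamma]\|\le \lambda\,\frac{q}{k}\,\|\Gamma\|$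 with $\lambda=6gk^2$. -/

import Mathlib

open scoped Matrix.Norms.L2Operator

namespace SpinSystem

/-- Operators on the Hilbert space `(ℂ^d)^{⊗N}` of `N` spins of dimension `d`, written in the
product basis `|x₁ … x_N⟩`, which is indexed by the configurations `x : Fin N → Fin d`.
The norm `‖A‖` is the operator norm on `ℓ²` (the largest singular value), through the scope
`Matrix.Norms.L2Operator`. -/
abbrev Op (N d : ℕ) : Type := Matrix (Fin N → Fin d) (Fin N → Fin d) ℂ

/-- `A` is supported in the set of sites `X`: `A = a ⊗ 1` with `a` an operator on the spins in `X`
and `1` the identity on the spins outside of `X`. -/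
def SupportedIn {N d : ℕ} (X : Finset (Fin N)) (A : Op N d) : Prop :=
  ∃ a : Matrix (X → Fin d) (X → Fin d) ℂ, ∀ x y : Fin N → Fin d,
    A x y = a (fun i => x i) (fun i => y i) * (if ∀ i, i ∉ X → x i = y i then 1 else 0)

/-- `A = ∑_{|X| ≤ q} γ_X` with each `γ_X` supported in `X`. -/
def IsLocalDecomposition {N d : ℕ} (q : ℕ) (A : Op N d) (γ : Finset (Fin N) → Op N d) : Prop :=
  (∀ X : Finset (Fin N), X.card ≤ q → SupportedIn X (γ X)) ∧
    A = ∑ X : Finset (Fin N) with X.card ≤ q, γ X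

/-- `q`-local operators. No self-adjointness and no bound on the terms is asked for. -/
def IsLocal {N d : ℕ} (q : ℕ) (A : Op N d) : Prop :=
  ∃ γ : Finset (Fin N) → Op N d, IsLocalDecomposition q A γ

/-- `k`-local `g`-extensive Hamiltonians: self-adjoint operators `H = ∑_{|X| ≤ k} h_X`, with `h_X`
supported in `X`, such that `∑_{X ∋ i} ‖h_X‖ ≤ g` for every site `i`. -/
def IsLocalExtensiveHamiltonian {N d : ℕ} (k : ℕ) (g : ℝ) (H : Op N d) : Prop :=
  H.IsHermitian ∧ ∃ h : Finset (Fin N) → Op N d, IsLocalDecomposition k H h ∧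
    ∀ i : Fin N, ∑ X : Finset (Fin N) with X.card ≤ k ∧ i ∈ X, ‖h X‖ ≤ g

end SpinSystem

/-! Rescale the Hermitian parts of the `h X` to norm at most one. Since `∑_{X ∋ i} ‖h X‖ ≤ g` and
`|X| ≤ k`, there is a random family `S` of pairwise disjoint sets containing each nonempty `X` with
probability `‖h X‖ / (g k)` (`exists_packing_distribution`). Up to a scalar, `H` is `g k` times the
average of `∑ X ∈ S, u X`, so it suffices to bound the commutator for a fixed packing.

There the terms commute, and a set of at most `q` sites meets at most `q` of them. After division by
`8 q`, the commutator with `A` acts on each term of `Γ` as that with a local part of norm at most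
`1/8`, whose adjoint action has spectrum in `[-1/4, 1/4]`. On that interval `y = ∑ c n e^{2πiny}`
with `∑ ‖c n‖ ≤ 1/3`, so `[A, Γ]` is a combination of unitary conjugates of the whole `Γ`. This
gives `8 q / 3` per packing and `8/3 ≤ 6` in the end. -/

namespace SpinSystem

open scoped Real

variable {N d : ℕ}

/-! ### Random packings with prescribed marginals -/

/-- Sets are offered one at a time: a new set `A` that is disjoint from the current family is
accepted with a probability tuned to give the marginal `p A`. A union bound over the sites of `A`
shows that it is free often enough. -/
theorem exists_packing_distribution {ι : Type*} [DecidableEq ι] {k : ℝ} (p : Finset ι → ℝ)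
    (𝒳 : Finset (Finset ι)) (hp : ∀ X ∈ 𝒳, 0 ≤ p X)
    (hX : ∀ X ∈ 𝒳, X.Nonempty ∧ (X.card : ℝ) ≤ k)
    (hsum : ∀ i, k * ∑ X ∈ 𝒳, (if i ∈ X then p X else 0) ≤ 1) :
    ∃ μ : Finset (Finset ι) → ℝ, (∀ S, 0 ≤ μ S) ∧
      (∀ S, μ S ≠ 0 → (S : Set (Finset ι)).PairwiseDisjoint id) ∧
      ∑ S ∈ 𝒳.powerset, μ S = 1 ∧
      ∀ X ∈ 𝒳, ∑ S ∈ 𝒳.powerset, (if X ∈ S then μ S else 0) = p X := by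
  classical
  induction 𝒳 using Finset.induction with
  | empty =>
    refine ⟨fun S => if S = ∅ then 1 else 0, fun S => by dsimp only; split_ifs <;> simp, ?_,
      by simp, by simp⟩
    intro S hS
    have : S = ∅ := by by_contra h; simp [h] at hS
    simp [this]
  | insert A 𝒳 hA ih =>
    have hpA : 0 ≤ p A := hp A (Finset.mem_insert_self _ _)
    obtain ⟨hAne, hAk⟩ := hX A (Finset.mem_insert_self _ _)
    have hcard : (1 : ℝ) ≤ A.card := by exact_mod_cast hAne.card_pos
    have hk : 0 ≤ k := by linarith
    have hp' : ∀ X ∈ 𝒳, 0 ≤ p X := fun X h => hp X (Finset.mem_insert_of_mem h)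
    have hsum' : ∀ i, k * ((if i ∈ A then p A else 0) + ∑ X ∈ 𝒳, (if i ∈ X then p X else 0)) ≤ 1 :=
      fun i => by simpa [Finset.sum_insert hA] using hsum i
    obtain ⟨μ, hμ0, hμd, hμ1, hμp⟩ := ih hp' (fun X h => hX X (Finset.mem_insert_of_mem h))
      (fun i => by
        refine le_trans (mul_le_mul_of_nonneg_left ?_ hk) (hsum' i)
        split_ifs <;> simp [hpA])
    let free : Finset (Finset ι) → Prop := fun S => ∀ X ∈ S, Disjoint A X
    set φ : ℝ := ∑ S ∈ 𝒳.powerset, if free S then μ S else 0 with hφ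
    -- the probability that some member of the random family meets `A`
    have hblocked : ∑ S ∈ 𝒳.powerset, (if free S then 0 else μ S) ≤
        ∑ i ∈ A, ∑ X ∈ 𝒳, (if i ∈ X then p X else 0) := by
      have h1 : ∀ i, ∑ X ∈ 𝒳, (if i ∈ X then p X else 0) =
          ∑ S ∈ 𝒳.powerset, ∑ X ∈ 𝒳, (if i ∈ X then (if X ∈ S then μ S else 0) else 0) := by
        intro i
        rw [Finset.sum_comm]
        refine Finset.sum_congr rfl fun X h => ?_
        split_ifs with hi
        · rw [hμp X h]
        · simp
      simp_rw [h1]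
      rw [Finset.sum_comm]
      refine Finset.sum_le_sum fun S hS => ?_
      have hnn : ∀ i ∈ A, 0 ≤ ∑ X ∈ 𝒳, (if i ∈ X then (if X ∈ S then μ S else 0) else 0) :=
        fun i _ => Finset.sum_nonneg fun X _ => by split_ifs <;> simp [hμ0]
      split_ifs with hf
      · exact Finset.sum_nonneg hnn
      · simp only [free, not_forall] at hf
        obtain ⟨X, hXS, hd⟩ := hf
        obtain ⟨i, hiA, hiX⟩ := Finset.not_disjoint_iff.1 hd
        refine le_trans ?_ (Finset.single_le_sum hnn hiA)
        refine le_trans ?_ (Finset.single_le_sum (fun X _ => ?_) (Finset.mem_powerset.1 hS hXS))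
        · simp [hiX, hXS]
        · split_ifs <;> simp [hμ0]
    have hφ1 : φ + ∑ S ∈ 𝒳.powerset, (if free S then 0 else μ S) = 1 := by
      rw [hφ, ← Finset.sum_add_distrib, ← hμ1]
      refine Finset.sum_congr rfl fun S _ => ?_
      split_ifs <;> simp
    -- Summing `hsum'` over `A` gives `|A| p A + P(blocked) ≤ |A| / k ≤ 1`, and `|A| ≥ 1`.
    have hpφ : p A ≤ φ := by
      have h2 : k * ∑ i ∈ A, (p A + ∑ X ∈ 𝒳, (if i ∈ X then p X else 0)) ≤ A.card := by
        rw [Finset.mul_sum]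
        refine le_trans (Finset.sum_le_card_nsmul A _ 1 fun i hi => ?_) (by simp)
        simpa [hi] using hsum' i
      rw [Finset.sum_add_distrib, Finset.sum_const, nsmul_eq_mul] at h2
      have h3 : (A.card : ℝ) * p A + ∑ i ∈ A, ∑ X ∈ 𝒳, (if i ∈ X then p X else 0) ≤ 1 := by
        by_contra hc
        push Not at hc
        have hk0 : 0 < k := by linarith
        nlinarith
      nlinarith
    have hφ0 : 0 ≤ φ := hpA.trans hpφ
    -- Acceptance probability given that `A` is free. If `φ = 0` then `p A = 0`, and the default `β
    -- = 0` is right.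
    set β : ℝ := p A / φ with hβ
    have hβφ : β * φ = p A := by
      rcases hφ0.eq_or_lt with h | h
      · rw [← h, mul_zero]; linarith
      · rw [hβ, div_mul_cancel₀ _ h.ne']
    have hβ0 : 0 ≤ β := div_nonneg hpA hφ0
    have hβ1 : β ≤ 1 := div_le_one_of_le₀ hpφ hφ0
    let ν : Finset (Finset ι) → ℝ := fun T =>
      if A ∈ T then (if free (T.erase A) then β * μ (T.erase A) else 0)
      else (if free T then (1 - β) * μ T else μ T)
    have hν1 : ∀ S ∈ 𝒳.powerset, ν S = (if free S then (1 - β) * μ S else μ S) := fun S hS => by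
      have hAS : A ∉ S := fun h => hA (Finset.mem_powerset.1 hS h)
      simp [ν, hAS]
    have hν2 : ∀ S ∈ 𝒳.powerset, ν (insert A S) = (if free S then β * μ S else 0) := fun S hS => by
      simp [ν, Finset.erase_insert fun h => hA (Finset.mem_powerset.1 hS h)]
    have hν3 : ∀ S ∈ 𝒳.powerset, ν S + ν (insert A S) = μ S := fun S hS => by
      rw [hν1 S hS, hν2 S hS]
      split_ifs <;> ring
    refine ⟨ν, fun T => ?_, fun T hT => ?_, ?_, fun X hXm => ?_⟩
    · have := hμ0 T
      have := hμ0 (T.erase A)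
      have := sub_nonneg.2 hβ1
      simp only [ν]
      split_ifs <;> positivity
    · by_cases hAT : A ∈ T
      · have hfree : free (T.erase A) := by
          by_contra h
          simp [ν, hAT, h] at hT
        have hμT : μ (T.erase A) ≠ 0 := by
          intro h
          simp [ν, hAT, h] at hT
        rw [← Finset.insert_erase hAT, Finset.coe_insert]
        exact (hμd _ hμT).insert fun X h _ => hfree X h
      · refine hμd T fun h => hT ?_
        simp [ν, hAT, h]
    · rw [Finset.sum_powerset_insert hA, ← Finset.sum_add_distrib, ← hμ1]
      exact Finset.sum_congr rfl hν3
    · rw [Finset.sum_powerset_insert hA]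
      rcases Finset.mem_insert.1 hXm with rfl | hX𝒳
      · rw [Finset.sum_eq_zero, zero_add, ← hβφ, hφ, Finset.mul_sum]
        · refine Finset.sum_congr rfl fun S hS => ?_
          rw [if_pos (Finset.mem_insert_self _ _), hν2 S hS]
          split_ifs <;> simp
        · intro S hS
          rw [if_neg fun h => hA (Finset.mem_powerset.1 hS h)]
      · rw [← Finset.sum_add_distrib, ← hμp X hX𝒳]
        refine Finset.sum_congr rfl fun S hS => ?_
        have hne : X ≠ A := fun h => hA (h ▸ hX𝒳)
        simp only [Finset.mem_insert, hne, false_or]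
        split_ifs
        · exact hν3 S hS
        · simp

/-! ### The commutator as a series of unitary conjugations -/

theorem bernoulliFun_two (x : ℝ) : bernoulliFun 2 x = x ^ 2 - x + 1 / 6 := by
  have h : bernoulli 2 = 1 / 6 := by rw [bernoulli_eq_bernoulli'_of_ne_one (by norm_num), bernoulli'_two]
  simp [bernoulliFun, Polynomial.bernoulli, Finset.sum_range_succ, h]
  ring

/-- The identity function is an absolutely convergent trigonometric series on `[-1/4, 1/4]`. -/
theorem exists_trigonometric_series_id :
    ∃ c : ℤ → ℂ, ∃ s : ℝ, s ≤ 1 / 3 ∧ HasSum (fun n => ‖c n‖) s ∧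
    ∀ y : ℝ, |y| ≤ 1 / 4 → HasSum (fun n : ℤ => c n * Complex.exp (2 * π * n * y * Complex.I)) y := by
  have hB := fun x hx => hasSum_one_div_pow_mul_fourier_mul_bernoulliFun le_rfl (x := x) hx
  have hπ : (π : ℂ) ≠ 0 := by exact_mod_cast Real.pi_ne_zero
  have hval : ∀ x : ℝ, -(2 * π * Complex.I) ^ 2 / (Nat.factorial 2 : ℂ) * bernoulliFun 2 x =
      (2 * π ^ 2 : ℂ) * (x ^ 2 - x + 1 / 6) := by
    intro x
    rw [bernoulliFun_two]
    push_cast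
    rw [mul_pow, Complex.I_sq]
    ring
  have hinv : HasSum (fun n : ℤ => 1 / (n : ℝ) ^ 2) (π ^ 2 / 3) := by
    have h := hB 0 (by simp)
    rw [hval] at h
    rw [← Complex.hasSum_ofReal]
    convert! h using 1
    · ext n
      simp
    · push_cast
      ring
  -- Fourier coefficients of `B₂(3/4 + y) - B₂(1/4 + y) = y`; both arguments stay in `[0, 1]` when
  -- `|y| ≤ 1/4`. Division by zero makes `c 0 = 0`.
  let c : ℤ → ℂ := fun n => 1 / (2 * π ^ 2) * (1 / (n : ℂ) ^ 2 *
    (Complex.exp (2 * π * Complex.I * n * (3 / 4 : ℝ)) -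
      Complex.exp (2 * π * Complex.I * n * (1 / 4 : ℝ))))
  have hcn : ∀ n, ‖c n‖ ≤ 1 / π ^ 2 * (1 / (n : ℝ) ^ 2) := by
    intro n
    have he : ∀ r : ℝ, ‖Complex.exp (2 * π * Complex.I * n * r)‖ = 1 := by
      intro r
      have : (2 * π * Complex.I * n * r : ℂ) = ((2 * π * n * r : ℝ) : ℂ) * Complex.I := by
        push_cast
        ring
      rw [this, Complex.norm_exp_ofReal_mul_I]
    have h2 := norm_sub_le (Complex.exp (2 * π * Complex.I * n * (3 / 4 : ℝ)))
      (Complex.exp (2 * π * Complex.I * n * (1 / 4 : ℝ)))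
    rw [he, he] at h2
    have h3 : ‖c n‖ = 1 / (2 * π ^ 2) * (1 / (n : ℝ) ^ 2 *
      ‖(Complex.exp (2 * π * Complex.I * n * (3 / 4 : ℝ)) -
      Complex.exp (2 * π * Complex.I * n * (1 / 4 : ℝ)))‖) := by
      simp only [c, norm_mul, norm_div, norm_pow, norm_one, Complex.norm_intCast, sq_abs,
        Complex.norm_real, Real.norm_eq_abs, Complex.norm_ofNat]
    rw [h3]
    calc _ ≤ 1 / (2 * π ^ 2) * (1 / (n : ℝ) ^ 2 * (1 + 1)) := by gcongr
      _ = _ := by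
        have := Real.pi_ne_zero
        field_simp
        ring
  have hmaj := hinv.mul_left (1 / π ^ 2)
  have hsum : Summable fun n => ‖c n‖ := Summable.of_nonneg_of_le (fun _ => norm_nonneg _) hcn hmaj.summable
  refine ⟨c, _, ?_, hsum.hasSum, fun y hy => ?_⟩
  · refine (hasSum_le hcn hsum.hasSum hmaj).trans (le_of_eq ?_)
    have := Real.pi_ne_zero
    field_simp
  · rw [abs_le] at hy
    have h1 := hB (3 / 4 + y) ⟨by linarith, by linarith⟩
    have h2 := hB (1 / 4 + y) ⟨by linarith, by linarith⟩
    rw [hval] at h1 h2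
    convert! (h1.sub h2).mul_left (1 / (2 * π ^ 2 : ℂ)) using 1
    · ext n
      simp only [c, fourier_coe_apply]
      rw [mul_assoc, mul_assoc, ← mul_sub, sub_mul, ← Complex.exp_add, ← Complex.exp_add]
      congr 4 <;> · push_cast; ring
    · rw [← mul_sub, ← mul_assoc, one_div_mul_cancel (mul_ne_zero two_ne_zero (pow_ne_zero 2 hπ))]
      push_cast
      ring

open Matrix in
-- In an eigenbasis of `A`, both sides multiply the entry `(a, b)` of `B` by a function of `λ_a -
-- λ_b`, which lies in `[-1/4, 1/4]`; the scalar series applies entrywise.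
theorem hasSum_conj_exp {m : Type*} [Fintype m] [DecidableEq m] {c : ℤ → ℂ}
    (hc : ∀ y : ℝ, |y| ≤ 1 / 4 →
      HasSum (fun n : ℤ => c n * Complex.exp (2 * π * n * y * Complex.I)) y)
    {A : Matrix m m ℂ} (hA : A.IsHermitian) (hA' : ‖A‖ ≤ 1 / 8) (B : Matrix m m ℂ) :
    HasSum (fun n : ℤ => c n • (NormedSpace.exp ((2 * π * n * Complex.I : ℂ) • A) * B *
      NormedSpace.exp (-((2 * π * n * Complex.I : ℂ) • A)))) (A * B - B * A) := by
  set U : Matrix m m ℂ := (hA.eigenvectorUnitary : Matrix m m ℂ) with hU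
  have h1 : U * star U = 1 := Unitary.coe_mul_star_self hA.eigenvectorUnitary
  have h2 : star U * U = 1 := Unitary.coe_star_mul_self hA.eigenvectorUnitary
  set D : m → ℂ := fun i => (hA.eigenvalues i : ℂ) with hD
  have hAD : A = U * diagonal D * star U := by
    have := hA.spectral_theorem
    rw [Unitary.conjStarAlgAut_apply] at this
    exact this
  have hDn : ∀ i, |hA.eigenvalues i| ≤ 1 / 8 := by
    intro i
    have h3 : diagonal D = star U * A * U := by
      rw [hAD]
      calc diagonal D = (star U * U) * diagonal D * (star U * U) := by rw [h2]; simp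
        _ = _ := by noncomm_ring
    have h4 : ‖(diagonal D : Matrix m m ℂ)‖ ≤ 1 / 8 := by
      rw [h3, CStarRing.norm_mul_mem_unitary _ hA.eigenvectorUnitary.2,
        CStarRing.norm_mem_unitary_mul _ (Unitary.star_mem hA.eigenvectorUnitary.2)]
      exact hA'
    rw [Matrix.l2_opNorm_diagonal] at h4
    have := (norm_le_pi_norm D i).trans h4
    simpa [hD] using this
  have hexp : ∀ z : ℂ, NormedSpace.exp (z • A) =
      U * diagonal (fun i => Complex.exp (z * D i)) * star U := by
    intro z
    have hinv : U⁻¹ = star U := Matrix.inv_eq_right_inv h1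
    have hunit : IsUnit U := ⟨⟨U, star U, h1, h2⟩, rfl⟩
    have : z • A = U * diagonal (z • D) * U⁻¹ := by
      rw [hinv, hAD, diagonal_smul]; simp
    rw [this, Matrix.exp_conj _ _ hunit, Matrix.exp_diagonal, hinv]
    congr 3
    ext i
    rw [Complex.exp_eq_exp_ℂ, Pi.coe_exp]
    rfl
  set M := star U * B * U with hM
  have hB : B = U * M * star U := by
    calc B = (U * star U) * B * (U * star U) := by rw [h1]; simp
      _ = _ := by rw [hM]; noncomm_ring
  have key : HasSum (fun n : ℤ => c n • (diagonal (fun i => Complex.exp ((2 * π * n * Complex.I : ℂ) * D i)) * M *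
      diagonal (fun i => Complex.exp (-(2 * π * n * Complex.I : ℂ) * D i)))) (diagonal D * M - M * diagonal D) := by
    refine Pi.hasSum.2 fun a => Pi.hasSum.2 fun b => ?_
    have hab : |hA.eigenvalues a - hA.eigenvalues b| ≤ 1 / 4 := by
      have := abs_sub (hA.eigenvalues a) (hA.eigenvalues b)
      linarith [hDn a, hDn b]
    have := (hc _ hab).mul_right (M a b)
    convert! this using 1
    · ext n
      simp only [Matrix.smul_apply, Matrix.mul_diagonal, Matrix.diagonal_mul, smul_eq_mul, hD]
      rw [mul_right_comm _ (M a b), ← Complex.exp_add, ← mul_assoc]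
      congr 3
      push_cast; ring
    · simp [Matrix.mul_diagonal, Matrix.diagonal_mul, hD]; ring
  have key2 := (key.mul_left U).mul_right (star U)
  convert! key2 using 1
  · ext1 n
    rw [← neg_smul, hexp, hexp, hB]
    simp only [Matrix.mul_smul, Matrix.smul_mul]
    congr 1
    calc _ = U * diagonal (fun i => Complex.exp ((2 * π * n * Complex.I : ℂ) * D i)) * (star U * U) * M * (star U * U) *
      diagonal (fun i => Complex.exp (-(2 * π * n * Complex.I : ℂ) * D i)) * star U := by noncomm_ring
      _ = _ := by rw [h2]; noncomm_ring
  · rw [hAD, hB]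
    calc _ = U * diagonal D * (star U * U) * M * star U - U * M * (star U * U) * diagonal D * star U := by noncomm_ring
      _ = _ := by rw [h2]; noncomm_ring

/-! ### Algebra of supports -/

theorem SupportedIn.apply_eq_zero {X : Finset (Fin N)} {A : Op N d} (hA : SupportedIn X A)
    {x y : Fin N → Fin d} {i : Fin N} (hi : i ∉ X) (hxy : x i ≠ y i) : A x y = 0 := by
  obtain ⟨a, ha⟩ := hA
  rw [ha, if_neg fun h => hxy (h i hi), mul_zero]

theorem SupportedIn.apply_congr {X : Finset (Fin N)} {A : Op N d} (hA : SupportedIn X A)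
    {x y x' y' : Fin N → Fin d} (hx : ∀ i ∈ X, x i = x' i) (hy : ∀ i ∈ X, y i = y' i)
    (hxy : ∀ i ∉ X, x i = y i) (hxy' : ∀ i ∉ X, x' i = y' i) : A x y = A x' y' := by
  obtain ⟨a, ha⟩ := hA
  rw [ha, ha, if_pos hxy, if_pos hxy', funext fun i : X => hx i i.2, funext fun i : X => hy i i.2]

/-- `A` fixes the spins outside `X` and `B` those in `X`, so a single intermediate configuration
contributes. -/
theorem SupportedIn.mul_apply {X Y : Finset (Fin N)} {A B : Op N d} (hA : SupportedIn X A)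
    (hB : SupportedIn Y B) (hXY : Disjoint X Y) (x z : Fin N → Fin d) :
    (A * B) x z = A x (fun i => if i ∈ X then z i else x i) *
      B (fun i => if i ∈ X then z i else x i) z := by
  rw [Matrix.mul_apply]
  refine Finset.sum_eq_single _ (fun y _ hy => ?_) fun h => absurd (Finset.mem_univ _) h
  obtain ⟨i, hi⟩ := Function.ne_iff.1 hy
  by_cases hX : i ∈ X
  · rw [if_pos hX] at hi
    rw [hB.apply_eq_zero (Finset.disjoint_left.1 hXY hX) hi, mul_zero]
  · rw [if_neg hX] at hi
    rw [hA.apply_eq_zero hX hi.symm, zero_mul]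

theorem SupportedIn.commute {X Y : Finset (Fin N)} {A B : Op N d} (hA : SupportedIn X A)
    (hB : SupportedIn Y B) (hXY : Disjoint X Y) : Commute A B := by
  ext x z
  rw [hA.mul_apply hB hXY, hB.mul_apply hA hXY.symm]
  by_cases h : ∀ i, i ∉ X → i ∉ Y → x i = z i
  · rw [mul_comm]
    have hd : ∀ i ∈ X, i ∉ Y := fun i hi => Finset.disjoint_left.1 hXY hi
    have hd' : ∀ i ∈ Y, i ∉ X := fun i hi => Finset.disjoint_right.1 hXY hi
    congr 1
    · apply hB.apply_congr <;> intro i hi <;> by_cases hX : i ∈ X <;> simp_all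
    · apply hA.apply_congr <;> intro i hi <;> by_cases hY : i ∈ Y <;> simp_all
  · push Not at h
    obtain ⟨i, hX, hY, hi⟩ := h
    rw [hB.apply_eq_zero hY (by simpa [hX] using hi), mul_zero,
      hA.apply_eq_zero hX (by simpa [hY] using hi), mul_zero]

theorem SupportedIn.smul {X : Finset (Fin N)} {A : Op N d} (hA : SupportedIn X A) (c : ℂ) :
    SupportedIn X (c • A) := by
  obtain ⟨a, ha⟩ := hA
  exact ⟨c • a, fun x y => by simp [ha]⟩

theorem SupportedIn.add {X : Finset (Fin N)} {A B : Op N d} (hA : SupportedIn X A)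
    (hB : SupportedIn X B) : SupportedIn X (A + B) := by
  obtain ⟨a, ha⟩ := hA
  obtain ⟨b, hb⟩ := hB
  exact ⟨a + b, fun x y => by rw [Matrix.add_apply, ha, hb, Matrix.add_apply, add_mul]⟩

theorem SupportedIn.conjTranspose {X : Finset (Fin N)} {A : Op N d} (hA : SupportedIn X A) :
    SupportedIn X A.conjTranspose := by
  obtain ⟨a, ha⟩ := hA
  refine ⟨a.conjTranspose, fun x y => ?_⟩
  rw [Matrix.conjTranspose_apply, ha, Matrix.conjTranspose_apply, star_mul']
  simp only [eq_comm]
  congr 1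
  split_ifs <;> simp

/-! ### Bernstein inequality from local parts -/

/-- The exponential of `A` factors through `A'` and `A - A'`; the second factor passes through `γ`
and cancels. -/
theorem exp_conj_eq_of_commute {m : Type*} [Fintype m] [DecidableEq m] {A A' γ : Matrix m m ℂ}
    (h : Commute A' A) (hγ : Commute (A - A') γ) (z : ℂ) :
    NormedSpace.exp (z • A) * γ * NormedSpace.exp (-(z • A)) =
      NormedSpace.exp (z • A') * γ * NormedSpace.exp (-(z • A')) := by
  have hc : Commute A' (A - A') := h.sub_right (Commute.refl A')
  have hz : Commute (z • A') (z • (A - A')) := (hc.smul_left z).smul_right z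
  have h1 : NormedSpace.exp (z • A) = NormedSpace.exp (z • A') * NormedSpace.exp (z • (A - A')) := by
    rw [← Matrix.exp_add_of_commute _ _ hz, ← smul_add]
    simp
  have h2 : NormedSpace.exp (-(z • A)) =
      NormedSpace.exp (-(z • (A - A'))) * NormedSpace.exp (-(z • A')) := by
    rw [← Matrix.exp_add_of_commute _ _ hz.symm.neg_left.neg_right, ← neg_add, ← smul_add]
    simp
  have h3 : NormedSpace.exp (z • (A - A')) * γ = γ * NormedSpace.exp (z • (A - A')) :=
    ((hγ.smul_left z).exp_left).eq
  have h4 : NormedSpace.exp (z • (A - A')) * NormedSpace.exp (-(z • (A - A'))) = 1 := by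
    rw [← Matrix.exp_add_of_commute _ _ (Commute.neg_right (Commute.refl (z • (A - A')))), add_neg_cancel,
      NormedSpace.exp_zero]
  calc _ = NormedSpace.exp (z • A') * (NormedSpace.exp (z • (A - A')) * γ) *
        NormedSpace.exp (-(z • (A - A'))) * NormedSpace.exp (-(z • A')) := by
        rw [h1, h2]; noncomm_ring
    _ = NormedSpace.exp (z • A') * γ * (NormedSpace.exp (z • (A - A')) *
        NormedSpace.exp (-(z • (A - A')))) * NormedSpace.exp (-(z • A')) := by
        rw [h3]; noncomm_ring
    _ = _ := by rw [h4, mul_one]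

theorem norm_conj_exp {m : Type*} [Fintype m] [DecidableEq m] {A : Matrix m m ℂ}
    (hA : A.IsHermitian) (t : ℝ) (B : Matrix m m ℂ) :
    ‖NormedSpace.exp ((t * Complex.I : ℂ) • A) * B *
      NormedSpace.exp (-((t * Complex.I : ℂ) • A))‖ = ‖B‖ := by
  set X := (t * Complex.I : ℂ) • A with hX
  have hXs : Matrix.conjTranspose X = -X := by
    rw [hX, Matrix.conjTranspose_smul, hA.eq]
    simp
  have hs : star (NormedSpace.exp X) = NormedSpace.exp (-X) := by
    rw [Matrix.star_eq_conjTranspose, ← Matrix.exp_conjTranspose, hXs]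
  have h1 : NormedSpace.exp X * NormedSpace.exp (-X) = 1 := by
    rw [← Matrix.exp_add_of_commute _ _ (Commute.neg_right (Commute.refl X)), add_neg_cancel,
      NormedSpace.exp_zero]
  have hU : NormedSpace.exp X ∈ unitary (Matrix m m ℂ) := by
    rw [Unitary.mem_iff, hs]
    exact ⟨mul_eq_one_comm.1 h1, h1⟩
  rw [← hs, CStarRing.norm_mul_mem_unitary _ (Unitary.star_mem hU),
    CStarRing.norm_mem_unitary_mul _ hU]

/-- A Bernstein inequality: on each term of `Γ`, the commutator with `A` acts as the commutator
with a Hermitian operator of norm at most `1 / 8`. -/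
theorem norm_commutator_le_of_local_part {m ι : Type*} [Fintype m] [DecidableEq m]
    {A : Matrix m m ℂ} (hA : A.IsHermitian) (s : Finset ι) (γ : ι → Matrix m m ℂ)
    (h : ∀ Y ∈ s, ∃ A' : Matrix m m ℂ, A'.IsHermitian ∧ ‖A'‖ ≤ 1 / 8 ∧ Commute A' A ∧
      Commute (A - A') (γ Y)) :
    ‖A * ∑ Y ∈ s, γ Y - (∑ Y ∈ s, γ Y) * A‖ ≤ 1 / 3 * ‖∑ Y ∈ s, γ Y‖ := by
  obtain ⟨c, r, hr, hcr, hc⟩ := exists_trigonometric_series_id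
  have hsum : HasSum (fun n : ℤ => c n • (NormedSpace.exp ((2 * π * n * Complex.I : ℂ) • A) *
      (∑ Y ∈ s, γ Y) * NormedSpace.exp (-((2 * π * n * Complex.I : ℂ) • A))))
      (A * ∑ Y ∈ s, γ Y - (∑ Y ∈ s, γ Y) * A) := by
    simp_rw [Finset.mul_sum, Finset.sum_mul, Finset.smul_sum]
    rw [← Finset.sum_sub_distrib]
    refine hasSum_sum fun Y hY => ?_
    obtain ⟨A', hA', hn, hcA, hcγ⟩ := h Y hY
    have := hasSum_conj_exp hc hA' hn (γ Y)
    have he : A * γ Y - γ Y * A = A' * γ Y - γ Y * A' := by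
      have := hcγ.eq
      rw [sub_mul, mul_sub, sub_eq_sub_iff_sub_eq_sub] at this
      exact this
    rw [he]
    -- Replacing `A'` by `A` makes the conjugations independent of `Y`, so the series add up to one
    -- for the whole sum, with no loss in the number of terms.
    simpa only [exp_conj_eq_of_commute hcA hcγ] using this
  have hle := hsum.norm_le_of_bounded (hcr.mul_right ‖∑ Y ∈ s, γ Y‖) fun n => by
    rw [norm_smul]
    have := norm_conj_exp hA (2 * π * n) (∑ Y ∈ s, γ Y)
    push_cast at this
    rw [this]
  exact hle.trans (mul_le_mul_of_nonneg_right hr (norm_nonneg _))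

/-! ### Commutator with a packing -/

theorem card_filter_not_disjoint_le {ι : Type*} [DecidableEq ι] {S : Finset (Finset ι)}
    (hS : (S : Set (Finset ι)).PairwiseDisjoint id) (Y : Finset ι) :
    (S.filter fun X => ¬ Disjoint X Y).card ≤ Y.card := by
  refine Finset.card_le_card_of_forall_subsingleton (fun X i => i ∈ X) (fun X hX => ?_) ?_
  · obtain ⟨i, hiX, hiY⟩ := Finset.not_disjoint_iff.1 (Finset.mem_filter.1 hX).2
    exact ⟨i, hiY, hiX⟩
  · rintro i - X ⟨hX, hiX⟩ X' ⟨hX', hiX'⟩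
    exact hS.elim_finset (Finset.mem_filter.1 hX).1 (Finset.mem_filter.1 hX').1 i hiX hiX'

/-- The commutator bound for a sum of commuting terms with pairwise disjoint supports. -/
theorem norm_commutator_packing_le {q : ℕ} (hq : 0 < q) {Γ : Op N d} (hΓ : IsLocal q Γ)
    {S : Finset (Finset (Fin N))} (hS : (S : Set (Finset (Fin N))).PairwiseDisjoint id)
    (u : Finset (Fin N) → Op N d) (hu : ∀ X ∈ S, SupportedIn X (u X))
    (hu' : ∀ X ∈ S, (u X).IsHermitian) (hn : ∀ X ∈ S, ‖u X‖ ≤ 1) :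
    ‖(∑ X ∈ S, u X) * Γ - Γ * ∑ X ∈ S, u X‖ ≤ 8 * q / 3 * ‖Γ‖ := by
  classical
  obtain ⟨γ, hγ, rfl⟩ := hΓ
  have hq' : (0 : ℝ) < q := by exact_mod_cast hq
  set G := ∑ Y : Finset (Fin N) with Y.card ≤ q, γ Y with hG
  have hherm : ∀ T ⊆ S, (((1 / (8 * q) : ℝ) : ℂ) • ∑ X ∈ T, u X).IsHermitian := by
    intro T hT
    unfold Matrix.IsHermitian
    rw [Matrix.conjTranspose_smul, Matrix.conjTranspose_sum]
    congr 1
    · simp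
    · exact Finset.sum_congr rfl fun X hX => hu' X (hT hX)
  have hcomm : ∀ X ∈ S, ∀ X' ∈ S, Commute (u X) (u X') := by
    intro X hX X' hX'
    by_cases h : X = X'
    · rw [h]
    · exact (hu X hX).commute (hu X' hX') (hS hX hX' h)
  have key := norm_commutator_le_of_local_part (hherm S subset_rfl)
    (Finset.univ.filter fun Y : Finset (Fin N) => Y.card ≤ q) γ (by
    intro Y hY
    have hYq : Y.card ≤ q := (Finset.mem_filter.1 hY).2
    -- The local part keeps the members of `S` meeting `Y`: at most `q` terms of norm at most one,
    -- hence the factor `1 / (8 q)`.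
    refine ⟨((1 / (8 * q) : ℝ) : ℂ) • ∑ X ∈ S with ¬ Disjoint X Y, u X,
      hherm _ (Finset.filter_subset _ _), ?_, ?_, ?_⟩
    · rw [norm_smul, Complex.norm_real, Real.norm_of_nonneg (by positivity)]
      have h1 : ‖∑ X ∈ S with ¬ Disjoint X Y, u X‖ ≤ q := by
        refine (norm_sum_le_of_le _ fun X hX => hn X (Finset.mem_filter.1 hX).1).trans ?_
        rw [Finset.sum_const, nsmul_eq_mul, mul_one]
        exact_mod_cast (card_filter_not_disjoint_le hS Y).trans hYq
      calc _ ≤ 1 / (8 * (q : ℝ)) * q := by gcongr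
        _ = _ := by field_simp
    · refine ((Commute.sum_left _ _ _ fun X hX => Commute.sum_right _ _ _ fun X' hX' => ?_).smul_left
        _).smul_right _
      exact hcomm X (Finset.mem_filter.1 hX).1 X' hX'
    · rw [← smul_sub, ← Finset.sum_filter_add_sum_filter_not S (fun X => ¬ Disjoint X Y),
        add_sub_cancel_left]
      refine (Commute.sum_left _ _ _ fun X hX => ?_).smul_left _
      rw [Finset.mem_filter, not_not] at hX
      exact (hu X hX.1).commute (hγ Y hYq) hX.2)
  rw [← hG, smul_mul_assoc, mul_smul_comm, ← smul_sub, norm_smul, Complex.norm_real,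
    Real.norm_of_nonneg (by positivity)] at key
  calc _ = 8 * q * (1 / (8 * q) * ‖(∑ X ∈ S, u X) * G - G * ∑ X ∈ S, u X‖) := by field_simp
    _ ≤ 8 * q * (1 / 3 * ‖G‖) := by gcongr
    _ = _ := by ring

/-! ### Averaging over packings -/

theorem norm_commutator_le_of_isLocalExtensiveHamiltonian {k q : ℕ} (hk : 0 < k) (hq : 0 < q)
    {g : ℝ} (hg : 0 ≤ g) {H Γ : Op N d} (hH : IsLocalExtensiveHamiltonian k g H)
    (hΓ : IsLocal q Γ) : ‖H * Γ - Γ * H‖ ≤ 8 / 3 * g * k * q * ‖Γ‖ := by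
  classical
  obtain ⟨hHh, h, ⟨hs, hsum⟩, hext⟩ := hH
  have hk' : (0 : ℝ) < k := by exact_mod_cast hk
  -- The `h X` need not be Hermitian, but their Hermitian parts still sum to `H`.
  let v : Finset (Fin N) → Op N d := fun X => (1 / 2 : ℂ) • (h X + (h X).conjTranspose)
  have hvs : ∀ X : Finset (Fin N), X.card ≤ k → SupportedIn X (v X) := fun X hX =>
    ((hs X hX).add (hs X hX).conjTranspose).smul _
  have hvh : ∀ X, (v X).conjTranspose = v X := fun X => by
    simp [v, Matrix.conjTranspose_smul, add_comm]
  have hvn : ∀ X, ‖v X‖ ≤ ‖h X‖ := fun X => by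
    have := norm_add_le (h X) (h X).conjTranspose
    rw [Matrix.l2_opNorm_conjTranspose] at this
    simp only [v, norm_smul]
    norm_num
    linarith
  have hHv : H = ∑ X : Finset (Fin N) with X.card ≤ k, v X := by
    rw [← Finset.smul_sum, Finset.sum_add_distrib, ← Matrix.conjTranspose_sum, ← hsum, hHh.eq,
      ← two_smul ℂ, smul_smul]
    norm_num
  -- Extensiveness does not control `h ∅`; its contribution is a scalar and drops out of the
  -- commutator.
  let 𝒳 : Finset (Finset (Fin N)) := Finset.univ.filter fun X => X.card ≤ k ∧ X.Nonempty
  have hle : ∀ X ∈ 𝒳, ‖h X‖ ≤ g := fun X hX => by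
    obtain ⟨hXk, i, hi⟩ := (Finset.mem_filter.1 hX).2
    exact (Finset.single_le_sum (f := fun X => ‖h X‖) (fun _ _ => norm_nonneg _)
      (Finset.mem_filter.2 ⟨Finset.mem_univ _, hXk, hi⟩)).trans (hext i)
  let p : Finset (Fin N) → ℝ := fun X => ‖h X‖ / g / k
  -- This survives `g = 0`, where `hle` forces `‖h X‖ = 0`.
  have hp : ∀ X ∈ 𝒳, g * k * p X = ‖h X‖ := fun X hX => by
    rcases hg.eq_or_lt with h0 | h0
    · have := hle X hX
      have := norm_nonneg (h X)
      rw [← h0]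
      linarith
    · simp only [p]
      field_simp
  obtain ⟨μ, hμ0, hμd, hμ1, hμp⟩ := exists_packing_distribution (k := k) p 𝒳
    (fun X _ => by positivity)
    (fun X hX => by
      obtain ⟨hXk, hne⟩ := (Finset.mem_filter.1 hX).2
      exact ⟨hne, by exact_mod_cast hXk⟩)
    (fun i => by
      rw [← Finset.sum_filter, ← Finset.sum_div, mul_div_cancel₀ _ hk'.ne', ← Finset.sum_div]
      refine div_le_one_of_le₀ (le_trans (Finset.sum_le_sum_of_subset_of_nonneg ?_
        fun _ _ _ => norm_nonneg _) (hext i)) hg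
      intro X hX
      simp only [𝒳, Finset.mem_filter, Finset.mem_univ, true_and] at hX ⊢
      exact ⟨hX.1.1, hX.2⟩)
  let u : Finset (Fin N) → Op N d := fun X => ((‖h X‖⁻¹ : ℝ) : ℂ) • v X
  have huv : ∀ X, ((‖h X‖ : ℝ) : ℂ) • u X = v X := fun X => by
    by_cases h0 : ‖h X‖ = 0
    · have : v X = 0 := norm_le_zero_iff.1 (h0 ▸ hvn X)
      simp [u, this]
    · simp only [u]
      rw [smul_smul, ← Complex.ofReal_mul, mul_inv_cancel₀ h0, Complex.ofReal_one, one_smul]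
  have hun : ∀ X, ‖u X‖ ≤ 1 := fun X => by
    simp only [u]
    rw [norm_smul, Complex.norm_real, Real.norm_of_nonneg (by positivity), inv_mul_eq_div]
    exact div_le_one_of_le₀ (hvn X) (norm_nonneg _)
  have huh : ∀ X, (u X).IsHermitian := fun X => by
    simp [Matrix.IsHermitian, u, Matrix.conjTranspose_smul, hvh X]
  let C : Op N d →ₗ[ℂ] Op N d := LinearMap.mulRight ℂ Γ - LinearMap.mulLeft ℂ Γ
  have hC : ∀ A, C A = A * Γ - Γ * A := fun A => rfl
  have hempty : C (v ∅) = 0 := by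
    obtain ⟨γ, hγ, rfl⟩ := hΓ
    rw [hC, sub_eq_zero]
    exact Commute.sum_right _ _ _ fun Y hY =>
      (hvs ∅ (by simp)).commute (hγ Y (Finset.mem_filter.1 hY).2) (Finset.disjoint_empty_left Y)
  have hCH : C H = ((g * k : ℝ) : ℂ) • ∑ S ∈ 𝒳.powerset, (μ S : ℂ) • C (∑ X ∈ S, u X) := by
    have h1 : C H = ∑ X ∈ 𝒳, C (v X) := by
      rw [hHv, map_sum]
      symm
      refine Finset.sum_subset (fun X hX => ?_) fun X hX hX' => ?_
      · simp only [𝒳, Finset.mem_filter, Finset.mem_univ, true_and] at hX ⊢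
        exact hX.1
      · simp only [𝒳, Finset.mem_filter, Finset.mem_univ, true_and, not_and,
          Finset.not_nonempty_iff_eq_empty] at hX hX'
        rw [hX' hX, hempty]
    have h2 : ∀ S ∈ 𝒳.powerset, (μ S : ℂ) • C (∑ X ∈ S, u X) =
        ∑ X ∈ 𝒳, ((if X ∈ S then μ S else 0 : ℝ) : ℂ) • C (u X) := fun S hS => by
      rw [map_sum, Finset.smul_sum, ← Finset.sum_subset (Finset.mem_powerset.1 hS)]
      · exact Finset.sum_congr rfl fun X hX => by rw [if_pos hX]
      · intro X _ hX
        rw [if_neg hX, Complex.ofReal_zero, zero_smul]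
    rw [h1, Finset.sum_congr rfl h2, Finset.sum_comm, Finset.smul_sum]
    refine Finset.sum_congr rfl fun X hX => ?_
    rw [← Finset.sum_smul, ← Complex.ofReal_sum, hμp X hX, smul_smul, ← Complex.ofReal_mul,
      hp X hX, ← map_smul, huv]
  rw [← hC, hCH, norm_smul, Complex.norm_real, Real.norm_of_nonneg (by positivity)]
  have hbound : ‖∑ S ∈ 𝒳.powerset, (μ S : ℂ) • C (∑ X ∈ S, u X)‖ ≤
      ∑ S ∈ 𝒳.powerset, μ S * (8 * q / 3 * ‖Γ‖) := by
    refine norm_sum_le_of_le _ fun S hS => ?_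
    rw [norm_smul, Complex.norm_real, Real.norm_of_nonneg (hμ0 S)]
    by_cases h0 : μ S = 0
    · simp [h0]
    · refine mul_le_mul_of_nonneg_left ?_ (hμ0 S)
      refine norm_commutator_packing_le hq hΓ (hμd S h0) u (fun X hX => ?_) (fun X _ => huh X)
        fun X _ => hun X
      exact (hvs X (Finset.mem_filter.1 (Finset.mem_powerset.1 hS hX)).2.1).smul _
  rw [← Finset.sum_mul, hμ1, one_mul] at hbound
  calc _ ≤ g * k * (8 * q / 3 * ‖Γ‖) := by gcongr
    _ = _ := by ring

end SpinSystem

theorem theorem1 (N d k q : ℕ) (hk : 0 < k) (hq : 0 < q) (g : ℝ) (hg : 0 ≤ g)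
    (H Γ : SpinSystem.Op N d)
    (hH : SpinSystem.IsLocalExtensiveHamiltonian k g H) (hΓ : SpinSystem.IsLocal q Γ) :
    ‖H * Γ - Γ * H‖ ≤ 6 * g * (k : ℝ) * (q : ℝ) * ‖Γ‖ ∧
      ‖H * Γ - Γ * H‖ ≤ (6 * g * (k : ℝ) ^ 2) * ((q : ℝ) / (k : ℝ)) * ‖Γ‖ := by
  have hk' : (k : ℝ) ≠ 0 := by exact_mod_cast hk.ne'
  have key : ‖H * Γ - Γ * H‖ ≤ 6 * g * (k : ℝ) * (q : ℝ) * ‖Γ‖ :=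
    (SpinSystem.norm_commutator_le_of_isLocalExtensiveHamiltonian hk hq hg hH hΓ).trans <| by
      gcongr
      norm_num
  refine ⟨key, key.trans (le_of_eq ?_)⟩
  field_simp
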